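/- Let $n\ge 0$ be an integer and write $[m]=\{1,\dots,m\}$. Let $B_m$ be the group (under composition) of all bijections $\sigma$ of $\{\pm1,\dots,\pm m\}$ onto itself with $\sigma(-i)=-\sigma(i)$ for all $i$, and let $L_m\subseteq B_m$ be the subgroup of those $\sigma$ for which $i\mapsto|\sigma(i)|$ is an even permutation of $[m]$. Let $s_0\in B_m$ exchange $1$ and $-1$ and fix every other letter, and for $1\le i\le m-1$ let $s_i\in B_m$ exchange $i$ with $i+1$ and $-i$ with $-(i+1)$ and fix every other letter. For $\sigma\in B_m$ let - $\ell_B(\sigma)$ be the least length of an expression of $\sigma$ as a product of the generators $s_0,\dots,s_{m-1}$; - $\mathrm{del}_B(\sigma)=\#\{2\le j\le m : \sigma(i)>\sigma(j)\text{ for all }1\le i<j\}$; - $\ell_L(\sigma)=\ell_B(\sigma)-\mathrm{del}_B(\sigma)$; - $\mathrm{Neg}(\sigma)=\{i\in[m]:\sigma(i)<0\}$. For $1\le i\le n-1$ let $a_i=s_1s_{i+1}\in L_{n+1}$, and for $\pi\in L_{n+1}$ let $$\mathrm{Des}_A(\pi)=\{1\le i\le n-1:\ell_L(\pi a_i)\le\ell_L(\pi)\},\qquad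 \mathrm{nrmaj}_{L_{n+1}}(\pi)=\sum_{i\in\mathrm{Des}_A(\pi)}(n-i)+\sum_{i\in\mathrm{Neg}(\pi^{-1})}i .$$ Then for every $B\subseteq[n+1]$, as polynomials in $q$, $$\sum_{\substack{\pi\in L_{n+1}\\ \mathrm{Neg}(\pi^{-1})=B}}q^{\mathrm{nrmaj}_{L_{n+1}}(\pi)}=\sum_{\substack{\pi\in L_{n+1}\\ \mathrm{Neg}(\pi^{-1})=B}}q^{\ell_L(\pi)} .$$ -/

import Mathlib

namespace SignedPerm

/-- The index set `[n] = {1, …, n}`. -/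
abbrev Idx (n : ℕ) : Type := {i : ℕ // i ∈ Finset.Icc 1 n}

/-- The set `{±1, …, ±n}`. -/
abbrev Letter (n : ℕ) : Type := {x : ℤ // x ∈ (Finset.Icc (-(n : ℤ)) n).erase 0}

/-- The negation `x ↦ -x` of `{±1, …, ±n}`. -/
instance (n : ℕ) : Neg (Letter n) :=
  ⟨fun x => ⟨-x.1, by
    have h := x.2
    simp only [Finset.mem_erase, Finset.mem_Icc] at h ⊢
    omega⟩⟩

theorem Letter.coe_neg {n : ℕ} (x : Letter n) : ((-x : Letter n) : ℤ) = -(x : ℤ) := rfl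

theorem Letter.neg_neg {n : ℕ} (x : Letter n) : - -x = x :=
  Subtype.ext (by simp [Letter.coe_neg])

/-- The inclusion of `[n]` into `{±1, …, ±n}`. -/
def pos {n : ℕ} (i : Idx n) : Letter n :=
  ⟨(i.1 : ℤ), by
    have h := i.2
    simp only [Finset.mem_erase, Finset.mem_Icc] at h ⊢
    omega⟩

/-- The absolute value `{±1, …, ±n} → [n]`. -/
def abs {n : ℕ} (x : Letter n) : Idx n :=
  ⟨x.1.natAbs, by
    have h := x.2
    simp only [Finset.mem_erase, Finset.mem_Icc] at h ⊢
    omega⟩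

theorem abs_pos {n : ℕ} (i : Idx n) : abs (pos i) = i := Subtype.ext (by simp [abs, pos])

theorem abs_neg {n : ℕ} (x : Letter n) : abs (-x) = abs x :=
  Subtype.ext (by simp [abs, Letter.coe_neg])

theorem pos_abs {n : ℕ} (x : Letter n) : pos (abs x) = x ∨ pos (abs x) = -x := by
  rcases le_total 0 x.1 with h | h
  · left
    apply Subtype.ext
    simp only [pos, abs]
    omega
  · right
    apply Subtype.ext
    simp only [pos, abs, Letter.coe_neg]
    omega

/-- The hyperoctahedral group `B_n = C₂ ≀ S_n`, as the group of all bijections `σ` of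
`{±1, …, ±n}` onto itself with `σ(-i) = -σ(i)`; the product is composition of maps. -/
def B (n : ℕ) : Subgroup (Equiv.Perm (Letter n)) where
  carrier := {σ | ∀ x, σ (-x) = -σ x}
  one_mem' := fun _ => rfl
  mul_mem' := fun {σ τ} hσ hτ x => by
    change σ (τ (-x)) = -σ (τ x)
    rw [hτ x, hσ]
  inv_mem' := fun {σ} hσ x => by
    change σ⁻¹ (-x) = -σ⁻¹ x
    rw [Equiv.Perm.inv_eq_iff_eq, hσ]
    exact congrArg Neg.neg (σ.apply_symm_apply x).symm

theorem map_neg {n : ℕ} (σ : B n) (x : Letter n) : σ.1 (-x) = -σ.1 x := σ.2 x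

/-- The `i`-th letter `σ(i)` of the window notation `[σ(1), …, σ(n)]`. -/
def window {n : ℕ} (σ : B n) (i : Idx n) : ℤ := (σ.1 (pos i)).1

theorem abs_apply_pos_abs {n : ℕ} (σ : B n) (x : Letter n) :
    abs (σ.1 (pos (abs x))) = abs (σ.1 x) := by
  rcases pos_abs x with h | h
  · rw [h]
  · rw [h, map_neg, abs_neg]

/-- The homomorphism `Abs : B_n → S_n` with `Abs(σ)(i) = |σ(i)|`. -/
def Abs (n : ℕ) : B n →* Equiv.Perm (Idx n) where
  toFun σ :=
    { toFun := fun i => abs (σ.1 (pos i))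
      invFun := fun i => abs ((σ⁻¹).1 (pos i))
      left_inv := fun i => by
        change abs ((σ⁻¹).1 (pos (abs (σ.1 (pos i))))) = i
        rw [abs_apply_pos_abs σ⁻¹]
        simp [abs_pos]
      right_inv := fun i => by
        change abs (σ.1 (pos (abs ((σ⁻¹).1 (pos i))))) = i
        rw [abs_apply_pos_abs σ]
        exact (congrArg abs (σ.1.apply_symm_apply (pos i))).trans (abs_pos i)}
  map_one' := Equiv.ext fun i => abs_pos i
  map_mul' σ τ := Equiv.ext fun i => (abs_apply_pos_abs σ (τ.1 (pos i))).symm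

/-- The group `L_n = C₂ ≀ A_n ⊆ B_n` of signed even permutations: those `σ` for which
`Abs(σ)` is an even permutation of `[n]`. -/
def L (n : ℕ) : Subgroup (B n) := (alternatingGroup (Idx n)).comap (Abs n)

noncomputable instance (n : ℕ) : Fintype (L n) := Fintype.ofFinite _

theorem swap_neg_neg {n : ℕ} (a b x : Letter n) :
    Equiv.swap (-a) (-b) (-x) = -Equiv.swap a b x := by
  have h : ∀ y z : Letter n, -y = -z ↔ y = z := fun y z =>
    ⟨fun e => by rw [← Letter.neg_neg y, e, Letter.neg_neg], fun e => by rw [e]⟩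
  simp only [Equiv.swap_apply_def, h]
  split_ifs <;> rfl

/-- For distinct `a, b ∈ [n]`, the signed permutation that exchanges `a` with `b` and `-a` with
`-b`. -/
def signedSwap {n : ℕ} (a b : Idx n) : B n :=
  ⟨Equiv.swap (pos a) (pos b) * Equiv.swap (-pos a) (-pos b), fun x => by
    have hne : ∀ c d : Idx n, pos c ≠ -pos d := fun c d e => by
      have e' := congrArg Subtype.val e
      have hc := c.2
      simp only [pos, Letter.coe_neg, Finset.mem_Icc] at e' hc
      omega
    have hcomm : Equiv.swap (pos a) (pos b) * Equiv.swap (-pos a) (-pos b)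
        = Equiv.swap (-pos a) (-pos b) * Equiv.swap (pos a) (pos b) := by
      refine (Equiv.Perm.Disjoint.commute fun y => ?_).eq
      by_cases h1 : y = pos a
      · subst h1
        exact Or.inr (Equiv.swap_apply_of_ne_of_ne (hne _ _) (hne _ _))
      · by_cases h2 : y = pos b
        · subst h2
          exact Or.inr (Equiv.swap_apply_of_ne_of_ne (hne _ _) (hne _ _))
        · exact Or.inl (Equiv.swap_apply_of_ne_of_ne h1 h2)
    have h1 := swap_neg_neg (pos a) (pos b)
    have h2 := swap_neg_neg (-pos a) (-pos b)
    simp only [Letter.neg_neg] at h2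
    calc _ = Equiv.swap (pos a) (pos b) (Equiv.swap (-pos a) (-pos b) (-x)) := rfl
      _ = -(Equiv.swap (-pos a) (-pos b) * Equiv.swap (pos a) (pos b)) x := by
        rw [h1, h2, Equiv.Perm.mul_apply]
      _ = _ := by rw [hcomm]⟩

/-- The signed permutation that exchanges `a` with `-a` and fixes all the other letters. -/
def signChange {n : ℕ} (a : Idx n) : B n :=
  ⟨Equiv.swap (pos a) (-pos a), fun x => by
    have h := swap_neg_neg (pos a) (-pos a) x
    rwa [Letter.neg_neg, Equiv.swap_comm] at h⟩

/-- The Coxeter generators `s_0, …, s_{n-1}` of `B_n`: `s_0 = [-1, 2, …, n]`, and `s_i` for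
`1 ≤ i ≤ n - 1` exchanges `i` and `i + 1` (and `-i` and `-(i + 1)`). -/
def s {n : ℕ} (i : Fin n) : B n :=
  if h : i.1 = 0 then
    signChange ⟨1, Finset.mem_Icc.2 (by have := i.2; omega)⟩
  else
    signedSwap ⟨i.1, Finset.mem_Icc.2 (by have := i.2; omega)⟩
      ⟨i.1 + 1, Finset.mem_Icc.2 (by have := i.2; omega)⟩

/-- The generators `a_i = s_1 s_{i+1}` of the alternating group `A_{n+1}`, as elements of
`B_{n+1}`. Only the indices `1 ≤ i ≤ n - 1` are meant (and used). -/
def a {n : ℕ} (i : Fin n) : B (n + 1) :=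
  s ⟨1, by have := i.2; omega⟩ * s ⟨i.1 + 1, by have := i.2; omega⟩

/-- The `B`-length: the least length of an expression of `σ` as a product of the Coxeter
generators `s_0, …, s_{n-1}`. -/
noncomputable def ellB {n : ℕ} (σ : B n) : ℕ :=
  sInf {k | ∃ w : List (Fin n), w.length = k ∧ (w.map s).prod = σ}

/-- `del_B(σ)`: the number of `2 ≤ j ≤ n` that are left-to-right minima of `σ`, that is,
`σ(i) > σ(j)` for all `1 ≤ i < j`. -/
def delB {n : ℕ} (σ : B n) : ℕ :=
  (Finset.univ.filter fun j : Idx n =>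
    2 ≤ j.1 ∧ ∀ i : Idx n, i.1 < j.1 → window σ j < window σ i).card

/-- The `L`-length `ℓ_L = ℓ_B - del_B`. The subtraction does not truncate: `del_B(σ)` is at most
the number of inversions of `σ`, which is at most `ℓ_B(σ)`. -/
noncomputable def ellL {n : ℕ} (σ : B n) : ℕ := ellB σ - delB σ

/-- `Neg(σ) = {i ∈ [n] : σ(i) < 0}`. -/
def negSet {n : ℕ} (σ : B n) : Finset (Idx n) :=
  Finset.univ.filter fun i => window σ i < 0

/-- The `A`-descent set of `π ∈ L_{n+1}`:
`Des_A(π) = {1 ≤ i ≤ n - 1 : ℓ_L(π a_i) ≤ ℓ_L(π)}`. -/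
noncomputable def desA {n : ℕ} (π : L (n + 1)) : Finset (Fin n) :=
  Finset.univ.filter fun i => 1 ≤ i.1 ∧ ellL (π.1 * a i) ≤ ellL π.1

/-- The alternating reverse major index of `π ∈ L_{n+1}`: the sum of `n - i` over the
`i ∈ Des_A(π)`. -/
noncomputable def rmaj {n : ℕ} (π : L (n + 1)) : ℕ := ∑ i ∈ desA π, (n - i.1)

/-- The negative alternating reverse major index of `π ∈ L_{n+1}`. -/
noncomputable def nrmaj {n : ℕ} (π : L (n + 1)) : ℕ :=
  rmaj π + ∑ i ∈ negSet (π.1⁻¹), i.1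

end SignedPerm

/-!
Write a signed permutation `π` as its word `π(1) … π(m)`, where `m = n + 1`, with inversion code
`b_j = #{i < j : π(i) > π(j)}`. The length formula `ellB_eq_lengthStat` says that `ℓ_B(π)` is
`∑ b_j` plus the sum of the absolute values of the negative letters, and the latter is
`∑ i ∈ Neg(π⁻¹), i`. The letter `π(j)` with `j ≥ 2` is a left-to-right minimum exactly when `b_j`
takes its largest value `j - 1`, so subtracting `del_B` replaces `b_j` by the capped value
`c_j = min(b_j, j - 2)` (`ellL_eq`). Comparing the capped codes of `π` and `π a_i` shows that
`i ∈ Des_A(π)` exactly when `c_{i+1} < c_{i+2}` (`ellL_mul_a_le_iff`). Hence both statistics are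
the common constant `∑ i ∈ B, i` plus a function of the list `u = (c_2, …, c_m)` of length `n`: the
sum of `u`, and the sum `ascSum u` of `n - i` over the ascents `i` of `u`.

This list does not change when the first two letters are exchanged, while the parity of `|π|` does;
so the sum over `L_m` is half the sum over `B_m` (`two_mul_sum_L`). With `Neg(π⁻¹) = B` fixed, the
words of the elements of `B_m` are all the arrangements of one fixed set of `m` integers
(`sum_negSet_eq`).

These arrangements are built by inserting the letters in increasing order. Inserting a new largest
letter into a word with capped code `u` puts a `0` somewhere into `u` and raises all later entries
by one, the two front positions having the same effect. For the sum of `u` the `|u| + 1` places for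
the `0` clearly add each of `0, …, |u|` once; as in Carlitz's argument for the major index, the same
holds for `ascSum` (`sum_ascSum_insertZero`). So both generating polynomials satisfy the recursion
with factor `1 + q + ⋯ + q^(|u| - 1) + 2 q^|u|`, and they agree (`sum_ascSum_eq_sum_sum`).
-/

namespace SignedPerm

open Polynomial

/-! ### Codes of words and the insertion of a largest letter -/

/-- The inversion code of the word `l` read after the prefix `pre`: for each letter, the number of
larger letters that precede it. The prefix matters only up to rearrangement and is kept reversed. -/
def code (pre : List ℤ) : List ℤ → List ℕ
  | [] => []
  | x :: l => pre.countP (x < ·) :: code (x :: pre) l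

/-- The capped inversion code of `l` read after the prefix `pre`: the number of larger letters that
precede a letter, but at most one less than the number of all preceding letters. For the first
letter of a word the truncated subtraction gives `0`, the right value. -/
def capCode (pre : List ℤ) : List ℤ → List ℕ
  | [] => []
  | x :: l => min (pre.countP (x < ·)) (pre.length - 1) :: capCode (x :: pre) l

/-- The sum of `n - i` over the ascents `i` of a list of length `n`, that is, over those
`1 ≤ i ≤ n - 1` for which the `i`-th entry is smaller than the next one. -/
def ascSum : List ℕ → ℕ
  | [] => 0
  | [_] => 0
  | x :: y :: l => (if x < y then l.length + 1 else 0) + ascSum (y :: l)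

/-- All the lists obtained by inserting a `0` into a given one and raising every entry after
it by one. -/
def insertZero : List ℕ → List (List ℕ)
  | [] => [[0]]
  | x :: l => (0 :: (x :: l).map (· + 1)) :: (insertZero l).map (x :: ·)

theorem code_perm {p p' : List ℤ} (h : p.Perm p') (l : List ℤ) : code p l = code p' l := by
  induction l generalizing p p' with
  | nil => rfl
  | cons x l ih => simp only [code, h.countP_eq, ih (h.cons x)]

theorem capCode_perm {p p' : List ℤ} (h : p.Perm p') (l : List ℤ) :
    capCode p l = capCode p' l := by
  induction l generalizing p p' with
  | nil => rfl
  | cons x l ih => simp only [capCode, h.countP_eq, h.length_eq, ih (h.cons x)]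

theorem code_append (p l₁ l₂ : List ℤ) :
    code p (l₁ ++ l₂) = code p l₁ ++ code (l₁.reverse ++ p) l₂ := by
  induction l₁ generalizing p with
  | nil => rfl
  | cons x l ih => simp [code, ih]

theorem capCode_append (p l₁ l₂ : List ℤ) :
    capCode p (l₁ ++ l₂) = capCode p l₁ ++ capCode (l₁.reverse ++ p) l₂ := by
  induction l₁ generalizing p with
  | nil => rfl
  | cons x l ih => simp [capCode, ih]

@[simp] theorem length_code (p l : List ℤ) : (code p l).length = l.length := by
  induction l generalizing p with
  | nil => rfl
  | cons x l ih => simp [code, ih]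

@[simp] theorem length_capCode (p l : List ℤ) : (capCode p l).length = l.length := by
  induction l generalizing p with
  | nil => rfl
  | cons x l ih => simp [capCode, ih]

theorem capCode_cons_max {p l : List ℤ} {M : ℤ} (hp : p ≠ []) (hl : ∀ x ∈ l, x < M) :
    capCode (M :: p) l = (capCode p l).map (· + 1) := by
  induction l generalizing p with
  | nil => rfl
  | cons x l ih =>
    have hx : x < M := hl x (by simp)
    have h1 : 0 < p.length := List.length_pos_iff.2 hp
    rw [capCode, capCode, List.map_cons, capCode_perm (.swap M x p),
      ih (by simp) (fun y hy => hl y (by simp [hy]))]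
    simp only [List.countP_cons, hx, decide_true, if_true, List.length_cons]
    congr 1
    omega

/-- On capped codes, inserting a new largest letter after a nonempty prefix is `insertZero`. -/
theorem map_capCode_insert {p l : List ℤ} {M : ℤ} (hp : p ≠ []) (hpM : ∀ x ∈ p, x < M)
    (hl : ∀ x ∈ l, x < M) :
    (List.permutations'Aux M l).map (capCode p) = insertZero (capCode p l) := by
  have h0 : ∀ q : List ℤ, (∀ x ∈ q, x < M) → q.countP (M < ·) = 0 := fun q hq => by
    rw [List.countP_eq_zero]
    intro y hy
    simpa using (hq y hy).le
  induction l generalizing p with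
  | nil => simp [capCode, insertZero, h0 p hpM]
  | cons x l ih =>
    have hx := hl x (by simp)
    have hl' : ∀ y ∈ l, y < M := fun y hy => hl y (by simp [hy])
    rw [List.permutations'Aux, List.map_cons, List.map_map]
    have := ih (p := x :: p) (by simp) (by simpa using ⟨hx, hpM⟩) hl'
    rw [show capCode p (x :: l) = min (p.countP (x < ·)) (p.length - 1) :: capCode (x :: p) l
      from rfl, insertZero, ← this, List.map_map]
    congr 1
    rw [capCode, capCode_cons_max hp hl, h0 p hpM]
    simp [capCode]

theorem ascSum_map_succ (u : List ℕ) : ascSum (u.map (· + 1)) = ascSum u := by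
  induction u with
  | nil => rfl
  | cons x l ih =>
    cases l with
    | nil => rfl
    | cons y l =>
      simp only [List.map_cons, ascSum, List.length_map, add_lt_add_iff_right] at ih ⊢
      rw [ih]

theorem ascSum_zero_cons_map_succ (u : List ℕ) :
    ascSum (0 :: u.map (· + 1)) = u.length + ascSum u := by
  cases u with
  | nil => rfl
  | cons x l =>
    have := ascSum_map_succ (x :: l)
    simp only [List.map_cons] at this
    simp [ascSum, this]

/-- The `|u| + 1` lists of `insertZero u` raise `ascSum` by `0, …, |u|`, each value once. -/
theorem sum_ascSum_insertZero (u : List ℕ) :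
    ((insertZero u).map fun v => (X : ℤ[X]) ^ ascSum v).sum =
      X ^ ascSum u * ∑ k ∈ Finset.range (u.length + 1), X ^ k := by
  have hlen : ∀ u : List ℕ, ∀ v ∈ insertZero u, v.length = u.length + 1 := by
    intro u
    induction u with
    | nil => simp [insertZero]
    | cons x l ih =>
      intro v hv
      rw [insertZero, List.mem_cons, List.mem_map] at hv
      rcases hv with rfl | ⟨v, hv, rfl⟩
      · simp
      · simp [ih v hv]
  induction u with
  | nil => simp [insertZero, ascSum]
  | cons x l ih =>
    rw [insertZero, List.map_cons, List.sum_cons, ascSum_zero_cons_map_succ, List.map_map]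
    cases l with
    | nil => simp [insertZero, ascSum, Finset.sum_range_succ, add_comm]
    | cons y l =>
      rw [insertZero, List.map_cons, List.sum_cons, ascSum_zero_cons_map_succ, List.map_map,
        Finset.sum_range_succ, mul_add, add_comm, pow_add, mul_comm (X ^ _) (X ^ _)] at ih
      -- The first list of `insertZero (y :: l)` carries the top power, so `ih'` is the sum over the
      -- other lists, those that still begin with `y`.
      have ih' := add_right_cancel ih
      rw [insertZero, List.map_cons, List.sum_cons, List.map_map, Function.comp_apply]
      have hfirst : ascSum (x :: 0 :: (y :: l).map (· + 1)) = (y :: l).length + ascSum (y :: l) := by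
        rw [ascSum, ascSum_zero_cons_map_succ]
        simp
      have hrest : ((insertZero l).map (((fun v => (X : ℤ[X]) ^ ascSum v) ∘ (x :: ·)) ∘ (y :: ·))).sum
          = X ^ (if x < y then l.length + 2 else 0) *
            ((insertZero l).map ((fun v => (X : ℤ[X]) ^ ascSum v) ∘ (y :: ·))).sum := by
        rw [← List.sum_map_mul_left]
        congr 1
        refine List.map_congr_left fun v hv => ?_
        have hv' := hlen l v hv
        split_ifs with hxy
        · simp only [Function.comp_apply, ascSum, hxy, if_true, hv', ← pow_add]
        · simp [ascSum, hxy]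
      rw [hfirst, hrest, ih', ascSum]
      have hS : ∑ k ∈ Finset.range (l.length + 1 + 1), (X : ℤ[X]) ^ k =
          X * ∑ k ∈ Finset.range (l.length + 1), X ^ k + 1 := by
        rw [Finset.sum_range_succ', Finset.mul_sum]
        simp [pow_succ']
      simp only [List.length_cons]
      rw [Finset.sum_range_succ _ (l.length + 1 + 1)]
      split_ifs
      · rw [hS]
        ring
      · rw [Finset.sum_range_succ _ (l.length + 1)]
        ring

theorem sum_sum_insertZero (u : List ℕ) :
    ((insertZero u).map fun v => (X : ℤ[X]) ^ v.sum).sum =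
      X ^ u.sum * ∑ k ∈ Finset.range (u.length + 1), X ^ k := by
  have h0 : ∀ u : List ℕ, (0 :: u.map (· + 1)).sum = u.length + u.sum := by
    intro u
    simp [List.sum_map_add, add_comm]
  induction u with
  | nil => simp [insertZero]
  | cons x l ih =>
    rw [insertZero, List.map_cons, List.sum_cons, h0, List.map_map, Finset.sum_range_succ, mul_add,
      List.length_cons]
    have : ((insertZero l).map ((fun v => (X : ℤ[X]) ^ v.sum) ∘ (x :: ·))).sum
        = X ^ x * ((insertZero l).map fun v => (X : ℤ[X]) ^ v.sum).sum := by
      rw [← List.sum_map_mul_left]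
      congr 1
      refine List.map_congr_left fun v hv => ?_
      simp [pow_add]
    rw [this, ih, List.sum_cons]
    ring

/-- Inserting a largest letter in front of a word or right after its first letter gives the same
capped code, so the first list of `insertZero` occurs twice. -/
theorem map_tail_capCode_insert {l : List ℤ} {x M : ℤ} (hx : x < M) (hl : ∀ y ∈ l, y < M) :
    (List.permutations'Aux M (x :: l)).map (fun w => (capCode [] w).tail) =
      (0 :: ((capCode [x] l).map (· + 1))) :: insertZero (capCode [x] l) := by
  rw [← map_capCode_insert (by simp) (by simpa using hx) hl, List.permutations'Aux, List.map_cons,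
    List.map_map]
  congr 1
  simp only [capCode, List.tail_cons]
  rw [capCode_perm (.swap M x []), capCode_cons_max (by simp) hl]
  simp

/-- Over all arrangements of a set of integers, listed decreasingly, `ascSum` and the sum of the
capped code are equidistributed. -/
theorem sum_ascSum_eq_sum_sum (l : List ℤ) (hl : l.Pairwise (· > ·)) :
    (l.permutations'.map fun w => (X : ℤ[X]) ^ ascSum (capCode [] w).tail).sum =
      (l.permutations'.map fun w => (X : ℤ[X]) ^ (capCode [] w).tail.sum).sum := by
  induction l with
  | nil => rfl
  | cons M l ih =>
    rw [List.pairwise_cons] at hl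
    rcases l with _ | ⟨z, l⟩
    · rfl
    have key : ∀ (f : List ℕ → ℕ),
        (∀ u : List ℕ, ((insertZero u).map fun v => (X : ℤ[X]) ^ f v).sum =
          X ^ f u * ∑ k ∈ Finset.range (u.length + 1), X ^ k) →
        (∀ u : List ℕ, f (0 :: u.map (· + 1)) = f u + u.length) →
        ((M :: z :: l).permutations'.map fun w => (X : ℤ[X]) ^ f (capCode [] w).tail).sum =
        ((z :: l).permutations'.map fun w => (X : ℤ[X]) ^ f (capCode [] w).tail).sum *
          (X ^ l.length + ∑ k ∈ Finset.range (l.length + 1), X ^ k) := by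
      intro f hf hf0
      rw [List.permutations', List.map_flatMap, List.flatMap, List.sum_flatten, List.map_map,
        ← List.sum_map_mul_right]
      congr 1
      refine List.map_congr_left fun w hw => ?_
      rw [List.mem_permutations'] at hw
      have hlen := hw.length_eq
      have hlt : ∀ y ∈ w, y < M := fun y hy => hl.1 y (hw.mem_iff.1 hy)
      rcases w with _ | ⟨x, w⟩
      · simp at hlen
      have h1 := map_tail_capCode_insert (l := w) (hlt x (by simp))
        (fun y hy => hlt y (by simp [hy]))
      have h2 := congrArg (fun L => (L.map fun v => (X : ℤ[X]) ^ f v).sum) h1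
      simp only [List.map_map, List.map_cons, List.sum_cons, hf, hf0] at h2
      simp only [List.length_cons, add_left_inj] at hlen
      rw [length_capCode, hlen] at h2
      refine Eq.trans ?_ (h2.trans ?_)
      · rfl
      · simp only [capCode, List.tail_cons]
        ring
    rw [key ascSum sum_ascSum_insertZero, key List.sum sum_sum_insertZero, ih hl.2]
    · intro u
      simp [List.sum_map_add]
    · intro u
      rw [ascSum_zero_cons_map_succ, add_comm]

/-! ### Words of signed permutations and the length formula -/

theorem sum_code_cons (p l : List ℤ) (x : ℤ) :
    (code (x :: p) l).sum = l.countP (· < x) + (code p l).sum := by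
  induction l generalizing p with
  | nil => rfl
  | cons y l ih =>
    rw [code, code, List.sum_cons, List.sum_cons, code_perm (.swap x y p), ih (y :: p),
      List.countP_cons, List.countP_cons]
    ring

/-- The sum of the absolute values of the negative letters of a word. -/
def negSum (w : List ℤ) : ℕ := (w.map fun x => (-x).toNat).sum

theorem negSum_perm {w w' : List ℤ} (h : w.Perm w') : negSum w = negSum w' :=
  (h.map _).sum_eq

/-- Creating a descent from an adjacent ascent adds one inversion. -/
theorem sum_code_swap (A l : List ℤ) {x y : ℤ} (h : x < y) :
    (code [] (A ++ y :: x :: l)).sum = (code [] (A ++ x :: y :: l)).sum + 1 := by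
  simp only [code_append, List.sum_append, code, List.sum_cons, List.countP_cons,
    code_perm (.swap x y (A.reverse ++ []))]
  simp only [h, decide_true, if_true, decide_eq_false h.le.not_gt]
  simp
  ring

theorem pos_ne_neg_pos {m : ℕ} (c d : Idx m) : pos c ≠ -pos d := fun e => by
  have e' := congrArg Subtype.val e
  have hc := c.2
  simp only [pos, Letter.coe_neg, Finset.mem_Icc] at e' hc
  omega

theorem window_mul_signedSwap {m : ℕ} (σ : B m) (a b j : Idx m) :
    window (σ * signedSwap a b) j = window σ (Equiv.swap a b j) := by
  have hpos : ∀ c d : Idx m, pos c = pos d ↔ c = d := fun c d =>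
    ⟨fun h => by rw [← abs_pos c, h, abs_pos], fun h => by rw [h]⟩
  have : (signedSwap a b).1 (pos j) = pos (Equiv.swap a b j) := by
    change Equiv.swap (pos a) (pos b) (Equiv.swap (-pos a) (-pos b) (pos j)) = _
    rw [Equiv.swap_apply_of_ne_of_ne (pos_ne_neg_pos _ _) (pos_ne_neg_pos _ _), Equiv.swap_apply_def,
      Equiv.swap_apply_def]
    simp only [hpos]
    split_ifs <;> rfl
  rw [window, window, ← this]
  rfl

theorem window_mul_signChange {m : ℕ} (σ : B m) (a j : Idx m) :
    window (σ * signChange a) j = if j = a then -window σ j else window σ j := by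
  change (σ.1 (Equiv.swap (pos a) (-pos a) (pos j))).1 = _
  split_ifs with h
  · rw [h, Equiv.swap_apply_left, map_neg]
    rfl
  · rw [Equiv.swap_apply_of_ne_of_ne (fun e => h (by rw [← abs_pos j, e, abs_pos]))
      (pos_ne_neg_pos _ _)]
    rfl

/-- The `k`-th index, counted from `0`. -/
def idx {m : ℕ} (k : Fin m) : Idx m := ⟨k.1 + 1, by have := k.2; simp⟩

/-- The order-preserving bijection from `Fin m` to `[m]`. -/
def idxEquiv (m : ℕ) : Fin m ≃ Idx m where
  toFun := idx
  invFun i := ⟨i.1 - 1, by have := Finset.mem_Icc.1 i.2; omega⟩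
  left_inv k := by simp [idx]
  right_inv i := by
    have := Finset.mem_Icc.1 i.2
    apply Subtype.ext
    simp only [idx]
    omega

/-- The window notation `σ(1), …, σ(m)` as a list. -/
def word {m : ℕ} (σ : B m) : List ℤ := List.ofFn fun k : Fin m => window σ (idx k)

@[simp] theorem length_word {m : ℕ} (σ : B m) : (word σ).length = m := by simp [word]

theorem getElem_word {m : ℕ} (σ : B m) (k : ℕ) (hk : k < (word σ).length) :
    (word σ)[k] = window σ (idx ⟨k, by simpa using hk⟩) := by simp [word]

theorem mem_word {m : ℕ} {σ : B m} {x : ℤ} : x ∈ word σ ↔ ∃ i, window σ i = x := by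
  rw [word, List.mem_ofFn]
  exact (idxEquiv m).exists_congr fun _ => Iff.rfl

theorem ext_window {m : ℕ} {σ τ : B m} (h : ∀ i, window σ i = window τ i) : σ = τ := by
  have h' : ∀ i, σ.1 (pos i) = τ.1 (pos i) := fun i => Subtype.ext (h i)
  apply Subtype.ext
  apply Equiv.ext
  intro x
  rcases pos_abs x with hx | hx
  · rw [← hx, h']
  · rw [← Letter.neg_neg x, ← hx, map_neg, map_neg τ, h']

theorem word_injective {m : ℕ} : Function.Injective (word (m := m)) := by
  intro σ τ h
  have h' := List.ofFn_injective h
  refine ext_window fun i => ?_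
  have := congrFun h' ((idxEquiv m).symm i)
  rwa [show idx ((idxEquiv m).symm i) = i from (idxEquiv m).apply_symm_apply i] at this

theorem natAbs_window {m : ℕ} (σ : B m) (i : Idx m) :
    (window σ i).natAbs = (Abs m σ i).1 := rfl

theorem natAbs_word_perm {m : ℕ} (σ : B m) :
    ((word σ).map Int.natAbs).Perm (List.range' 1 m) := by
  rw [List.perm_ext_iff_of_nodup _ (List.nodup_range' ..)]
  · intro k
    rw [List.mem_map, List.mem_range'_1]
    constructor
    · rintro ⟨x, hx, rfl⟩
      obtain ⟨i, rfl⟩ := mem_word.1 hx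
      have := Finset.mem_Icc.1 (Abs m σ i).2
      rw [natAbs_window]
      omega
    · intro hk
      refine ⟨window σ ((Abs m σ).symm ⟨k, by simp; omega⟩), mem_word.2 ⟨_, rfl⟩, ?_⟩
      rw [natAbs_window, Equiv.apply_symm_apply]
  · rw [word, List.map_ofFn, List.nodup_ofFn]
    intro k l h
    simp only [Function.comp_apply, natAbs_window] at h
    exact (idxEquiv m).injective ((Abs m σ).injective (Subtype.ext h))

theorem nodup_natAbs_word {m : ℕ} (σ : B m) : ((word σ).map Int.natAbs).Nodup :=
  (natAbs_word_perm σ).nodup_iff.2 (List.nodup_range' ..)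

theorem nodup_word {m : ℕ} (σ : B m) : (word σ).Nodup := (nodup_natAbs_word σ).of_map

theorem ne_zero_of_mem_word {m : ℕ} {σ : B m} {x : ℤ} (h : x ∈ word σ) : x ≠ 0 := by
  have := (natAbs_word_perm σ).mem_iff.1 (List.mem_map_of_mem (f := Int.natAbs) h)
  rw [List.mem_range'_1] at this
  omega

theorem word_one {m : ℕ} : word (1 : B m) = (List.range' 1 m).map (↑) := by
  apply List.ext_getElem
  · simp
  · intro k h1 h2
    rw [getElem_word]
    simp [window, pos, idx, add_comm]

theorem window_mul_s_zero {m : ℕ} (hm : 0 < m) (σ : B m) (j : Idx m) :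
    window (σ * s ⟨0, hm⟩) j = if j = idx ⟨0, hm⟩ then -window σ j else window σ j := by
  rw [show s ⟨0, hm⟩ = signChange (idx ⟨0, hm⟩) from dif_pos rfl, window_mul_signChange]

theorem window_mul_s {m : ℕ} {i : Fin m} (h : i.1 ≠ 0) (σ : B m) (j : Idx m) :
    window (σ * s i) j = window σ (Equiv.swap
      ⟨i.1, Finset.mem_Icc.2 (by have := i.2; omega)⟩ (idx i) j) := by
  rw [show s i = signedSwap _ (idx i) from dif_neg h, window_mul_signedSwap]

theorem word_mul_s_zero {m : ℕ} (hm : 0 < m) {σ : B m} {x : ℤ} {l : List ℤ}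
    (h : word σ = x :: l) : word (σ * s ⟨0, hm⟩) = -x :: l := by
  have hl := congrArg List.length h
  apply List.ext_getElem
  · simpa using hl
  intro k h1 h2
  have h3 : k < (word σ).length := by simpa using h1
  have h4 : (word σ)[k] = (x :: l)[k]'(h ▸ h3) := by simp only [h]
  rw [getElem_word] at h4 ⊢
  rw [window_mul_s_zero, h4]
  rcases k with _ | k
  · simp [idx]
  · simp [idx]

theorem word_mul_s {m : ℕ} {i : Fin m} {σ : B m} {x y : ℤ} {A l : List ℤ}
    (h : word σ = A ++ x :: y :: l) (hi : i.1 = A.length + 1) :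
    word (σ * s i) = A ++ y :: x :: l := by
  have hl := congrArg List.length h
  simp only [length_word, List.length_append, List.length_cons] at hl
  apply List.ext_getElem
  · simp [hl]
  intro k h1 h2
  have key : ∀ k (hk : k < m), window σ (idx ⟨k, hk⟩) =
      (A ++ x :: y :: l)[k]'(by simp; omega) := fun k hk => by
    rw [← getElem_word σ k (by simpa using hk)]
    simp only [h]
  rw [length_word] at h1
  rw [getElem_word, window_mul_s (by omega), Equiv.swap_apply_def]
  simp only [idx, Subtype.mk.injEq]
  split_ifs with c1 c2
  · have := key i.1 i.2
    simp only [idx] at this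
    rw [this]
    have : k = A.length := by omega
    subst this
    simp [hi]
  · have := key (i.1 - 1) (by omega)
    have e : i.1 - 1 + 1 = i.1 := by omega
    simp only [idx, e] at this
    rw [this]
    have : k = A.length + 1 := by omega
    subst this
    simp [hi]
  · have := key k h1
    simp only [idx] at this
    rw [this]
    rcases lt_or_ge k A.length with hk | hk
    · rw [List.getElem_append_left hk, List.getElem_append_left hk]
    · obtain ⟨d, rfl⟩ := Nat.exists_eq_add_of_le hk
      rcases d with _ | _ | d
      · omega
      · omega
      · simp

theorem exists_word_eq_append {m : ℕ} (σ : B m) {i : ℕ} (hi : 0 < i) (him : i < m) :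
    ∃ (A : List ℤ) (x y : ℤ) (l : List ℤ), word σ = A ++ x :: y :: l ∧ i = A.length + 1 := by
  refine ⟨(word σ).take (i - 1), (word σ)[i - 1]'(by simp; omega), (word σ)[i]'(by simpa),
    (word σ).drop (i + 1), ?_, by simp; omega⟩
  conv_lhs => rw [← List.take_append_drop (i - 1) (word σ)]
  congr 1
  rw [List.drop_eq_getElem_cons (by simp; omega)]
  have e : i - 1 + 1 = i := by omega
  rw [e, List.drop_eq_getElem_cons (by simpa)]

theorem mul_s_mul_s {m : ℕ} (σ : B m) (i : Fin m) : σ * s i * s i = σ := by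
  apply word_injective
  rcases Nat.eq_zero_or_pos i.1 with h | h
  · obtain ⟨i, hm⟩ := i
    subst h
    have hlen := length_word σ
    cases hw : word σ with
    | nil => simp [hw] at hlen; omega
    | cons x l => rw [word_mul_s_zero hm (word_mul_s_zero hm hw), neg_neg]
  · obtain ⟨A, x, y, l, hw, hi⟩ := exists_word_eq_append σ h i.2
    rw [word_mul_s (word_mul_s hw hi) hi, hw]

/-- The number of inversions plus the sum of the absolute values of the negative letters; it
computes the `B`-length. -/
def lengthStat (w : List ℤ) : ℕ := (code [] w).sum + negSum w

/-- Changing the sign of a positive first letter `x` raises the negative sum by `x` and destroys the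
inversions with the letters `y`, `|y| < x`, of which there are `x - 1`. -/
theorem lengthStat_mul_s_zero {m : ℕ} (hm : 0 < m) {σ : B m} {x : ℤ} {l : List ℤ}
    (h : word σ = x :: l) (hx : 0 < x) :
    lengthStat (word (σ * s ⟨0, hm⟩)) = lengthStat (word σ) + 1 := by
  rw [word_mul_s_zero hm h, h, lengthStat, lengthStat, code, code, List.sum_cons, List.sum_cons,
    sum_code_cons, sum_code_cons]
  have hmem : x.natAbs ∈ (word σ).map Int.natAbs := by rw [h]; simp
  have hr := (natAbs_word_perm σ).mem_iff.1 hmem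
  rw [List.mem_range'_1] at hr
  have hnd := nodup_natAbs_word σ
  rw [h, List.map_cons, List.nodup_cons] at hnd
  have h1 : l.countP (fun y => y.natAbs < x.natAbs) = x.natAbs - 1 := by
    have e := (natAbs_word_perm σ).countP_eq (· < x.natAbs)
    rw [h, List.map_cons, List.countP_cons] at e
    rw [List.countP_map] at e
    simp only [lt_irrefl, decide_false, Bool.false_eq_true, if_false, add_zero] at e
    refine Eq.trans ?_ (e.trans ?_)
    · rfl
    · obtain ⟨d, hd⟩ : ∃ d, m = (x.natAbs - 1) + d := ⟨m - (x.natAbs - 1), by omega⟩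
      conv_lhs => rw [hd]
      rw [← List.range'_append_1, List.countP_append, List.countP_eq_length.2, List.countP_eq_zero.2]
      · simp
      · intro a ha
        rw [List.mem_range'_1] at ha
        simp
        omega
      · intro a ha
        rw [List.mem_range'_1] at ha
        simp
        omega
  have h2 : l.countP (· < x) = l.countP (· < -x) + l.countP (fun y => y.natAbs < x.natAbs) := by
    have hnm := hnd.1
    clear h h1 hmem hr hnd
    induction l with
    | nil => rfl
    | cons y l ih =>
      rw [List.map_cons, List.mem_cons, not_or] at hnm
      rw [List.countP_cons, List.countP_cons, List.countP_cons, ih hnm.2]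
      have := hnm.1
      simp only [decide_eq_true_eq]
      split_ifs <;> omega
  rw [h2, h1]
  simp only [negSum, List.map_cons, List.sum_cons]
  simp
  omega

theorem lengthStat_mul_s {m : ℕ} {i : Fin m} {σ : B m} {x y : ℤ} {A l : List ℤ}
    (h : word σ = A ++ x :: y :: l) (hi : i.1 = A.length + 1) (hxy : x < y) :
    lengthStat (word (σ * s i)) = lengthStat (word σ) + 1 := by
  rw [word_mul_s h hi, h, lengthStat, lengthStat, sum_code_swap A l hxy,
    negSum_perm ((List.Perm.swap x y l).append_left A)]
  ring

theorem lengthStat_one {m : ℕ} : lengthStat (word (1 : B m)) = 0 := by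
  have h : ∀ (l p : List ℤ), (p ++ l).Pairwise (· < ·) → (code p l).sum = 0 := by
    intro l
    induction l with
    | nil => intros; rfl
    | cons x l ih =>
      intro p hp
      have h1 := (List.pairwise_append.1 hp).2.2
      rw [code, code_perm (p' := p ++ [x]) (by simpa using (List.perm_append_comm (l₁ := [x]))),
        List.sum_cons, ih, List.countP_eq_zero.2]
      · intro a ha
        simpa using (h1 a ha x (by simp)).le
      · simpa using hp
  rw [lengthStat, h _ [], negSum, List.sum_eq_zero]
  · rfl
  · intro k hk
    rw [word_one] at hk
    simp only [List.map_map, List.mem_map, Function.comp_apply] at hk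
    obtain ⟨a, -, rfl⟩ := hk
    simp
  · rw [List.nil_append, word_one, List.pairwise_map]
    exact (List.pairwise_lt_range' ..).imp fun h => by exact_mod_cast h

/-- A word without descents whose first letter is positive is the identity, so any other signed
permutation can be shortened. -/
theorem exists_lengthStat_descent {m : ℕ} (σ : B m) (hσ : σ ≠ 1) :
    ∃ i, lengthStat (word σ) = lengthStat (word (σ * s i)) + 1 := by
  by_contra! hcon
  have hlen := length_word σ
  have hhead : ∀ x l, word σ = x :: l → 0 < x := by
    intro x l h
    have hx := ne_zero_of_mem_word (σ := σ) (x := x) (by simp [h])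
    by_contra hneg
    have hm : 0 < m := by rw [h] at hlen; simp at hlen; omega
    have h' := lengthStat_mul_s_zero hm (word_mul_s_zero hm h) (by omega)
    rw [mul_s_mul_s] at h'
    exact hcon _ h'
  have hsorted : (word σ).IsChain (· < ·) := by
    rw [List.isChain_iff_forall_rel_of_append_cons_cons]
    intro x y A l h
    have hne : x ≠ y := by
      have := nodup_word σ
      rw [h] at this
      rintro rfl
      simpa using (List.nodup_append.1 this).2.1
    by_contra hxy
    have hm : A.length + 1 < m := by rw [h] at hlen; simp at hlen; omega
    have h' := lengthStat_mul_s (i := ⟨_, hm⟩) (word_mul_s (i := ⟨_, hm⟩) h rfl) rfl (by omega)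
    rw [mul_s_mul_s] at h'
    exact hcon _ h'
  rw [List.isChain_iff_pairwise] at hsorted
  have hpos : ∀ x ∈ word σ, 0 < x := by
    cases hw : word σ with
    | nil => simp
    | cons x l =>
      rw [hw, List.pairwise_cons] at hsorted
      have := hhead x l hw
      intro y hy
      rcases List.mem_cons.1 hy with rfl | hy
      · exact this
      · exact this.trans (hsorted.1 y hy)
  have hmap : (word σ).map Int.natAbs = List.range' 1 m := by
    refine (natAbs_word_perm σ).eq_of_pairwise' (r := (· < ·)) ?_ (List.pairwise_lt_range' ..)
    rw [List.pairwise_map]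
    exact hsorted.imp_of_mem fun {a b} ha hb hab => by
      have := hpos a ha
      have := hpos b hb
      omega
  apply hσ
  apply word_injective
  rw [word_one, ← hmap, List.map_map]
  conv_lhs => rw [← List.map_id (word σ)]
  refine List.map_congr_left fun x hx => ?_
  have := hpos x hx
  simp only [id, Function.comp_apply]
  omega

/-- The length formula for the hyperoctahedral group. -/
theorem ellB_eq_lengthStat {m : ℕ} (σ : B m) : ellB σ = lengthStat (word σ) := by
  have step : ∀ (σ : B m) (i : Fin m), lengthStat (word (σ * s i)) ≤ lengthStat (word σ) + 1 := by
    intro σ i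
    rcases Nat.eq_zero_or_pos i.1 with h | h
    · obtain ⟨i, hm⟩ := i
      subst h
      have hlen := length_word σ
      cases hw : word σ with
      | nil => simp [hw] at hlen; omega
      | cons x l =>
        rcases lt_or_ge 0 x with hx | hx
        · rw [lengthStat_mul_s_zero hm hw hx, hw]
        · have hx0 := ne_zero_of_mem_word (σ := σ) (x := x) (by simp [hw])
          have h' := lengthStat_mul_s_zero hm (word_mul_s_zero hm hw) (by omega)
          rw [mul_s_mul_s, hw] at h'
          omega
    · obtain ⟨A, x, y, l, hw, hi⟩ := exists_word_eq_append σ h i.2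
      rcases lt_or_ge x y with hxy | hxy
      · rw [lengthStat_mul_s hw hi hxy]
      · rcases hxy.eq_or_lt with rfl | hxy
        · rw [word_mul_s hw hi, ← hw]
          omega
        · have h' := lengthStat_mul_s (word_mul_s hw hi) hi hxy
          rw [mul_s_mul_s] at h'
          omega
  have lower : ∀ w : List (Fin m), lengthStat (word (w.map s).prod) ≤ w.length := by
    intro w
    induction w using List.reverseRecOn with
    | nil => simp [lengthStat_one]
    | append_singleton w i ih =>
      rw [List.map_append, List.prod_append]
      have := step (w.map s).prod i
      simp only [List.map_cons, List.map_nil, List.prod_singleton, List.length_append,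
        List.length_singleton]
      omega
  have upper : ∀ (k : ℕ) (σ : B m), lengthStat (word σ) = k →
      ∃ w : List (Fin m), w.length = k ∧ (w.map s).prod = σ := by
    intro k
    induction k with
    | zero =>
      intro σ h
      by_cases hσ : σ = 1
      · exact ⟨[], rfl, by simp [hσ]⟩
      · obtain ⟨i, hi⟩ := exists_lengthStat_descent σ hσ
        omega
    | succ k ih =>
      intro σ h
      have hσ : σ ≠ 1 := by
        rintro rfl
        rw [lengthStat_one] at h
        omega
      obtain ⟨i, hi⟩ := exists_lengthStat_descent σ hσ
      obtain ⟨w, hw, hp⟩ := ih (σ * s i) (by omega)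
      refine ⟨w ++ [i], by simp [hw], ?_⟩
      simp [hp, mul_s_mul_s]
  apply le_antisymm
  · exact Nat.sInf_le (upper _ σ rfl)
  · obtain ⟨w, hw, hp⟩ := Nat.sInf_mem (s := {k | ∃ w : List (Fin m), w.length = k ∧
      (w.map s).prod = σ}) ⟨_, upper _ σ rfl⟩
    rw [ellB, ← hw]
    conv_lhs => rw [← hp]
    exact lower w

/-! ### The statistics in terms of the capped code -/

theorem getElem_code (p l : List ℤ) (k : ℕ) (hk : k < (code p l).length) :
    (code p l)[k] = p.countP (l[k]'(by simpa using hk) < ·) +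
      (l.take k).countP (l[k]'(by simpa using hk) < ·) := by
  induction l generalizing p k with
  | nil => simp [code] at hk
  | cons x l ih =>
    rcases k with _ | k
    · simp [code]
    · have hk' : k < (code (x :: p) l).length := by simpa [code] using hk
      have := ih (x :: p) k hk'
      simp only [code, List.getElem_cons_succ, this, List.countP_cons, List.take_succ_cons]
      ring

theorem getElem_capCode (p l : List ℤ) (k : ℕ) (hk : k < (capCode p l).length) :
    (capCode p l)[k] = min ((code p l)[k]'(by simpa using hk)) (p.length + k - 1) := by
  induction l generalizing p k with
  | nil => simp [capCode] at hk
  | cons x l ih =>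
    rcases k with _ | k
    · simp [capCode, code]
    · have hk' : k < (capCode (x :: p) l).length := by simpa [capCode] using hk
      have := ih (x :: p) k hk'
      simp only [capCode, code, List.getElem_cons_succ, this, List.length_cons]
      congr 1
      omega

theorem sum_eq_sum_fin (l : List ℕ) {m : ℕ} (h : l.length = m) :
    l.sum = ∑ k : Fin m, l[k.1]'(h ▸ k.2) := by
  subst h
  conv_lhs => rw [← List.ofFn_getElem (xs := l)]
  rw [List.sum_ofFn]

/-- An entry of the code exceeds its cap, by one, exactly at the left-to-right minima other than the
first letter. -/
theorem sum_code_word {m : ℕ} (σ : B m) :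
    (code [] (word σ)).sum = (capCode [] (word σ)).sum + delB σ := by
  rw [delB, Finset.card_filter, ← (idxEquiv m).sum_comp, sum_eq_sum_fin _ (m := m) (by simp),
    sum_eq_sum_fin (capCode [] (word σ)) (m := m) (by simp), ← Finset.sum_add_distrib]
  refine Finset.sum_congr rfl fun k _ => ?_
  have hk : k.1 < (word σ).length := by simp
  have hlen : ((word σ).take k.1).length = k.1 := by simp
  have hle : ((word σ).take k.1).countP ((word σ)[k.1] < ·) ≤ k.1 :=
    List.countP_le_length.trans hlen.le
  have hiff : ((word σ).take k.1).countP ((word σ)[k.1] < ·) = k.1 ↔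
      ∀ i : Idx m, i.1 < (idx k).1 → window σ (idx k) < window σ i := by
    conv_lhs => rhs; rw [← hlen]
    rw [List.countP_eq_length]
    constructor
    · intro h i hi
      have hi1 := Finset.mem_Icc.1 i.2
      have hlt : i.1 - 1 < k.1 := by simp only [idx] at hi; omega
      have := h _ (List.getElem_mem (l := (word σ).take k.1) (n := i.1 - 1) (by omega))
      rw [List.getElem_take, getElem_word, getElem_word, decide_eq_true_eq] at this
      rwa [show idx ⟨i.1 - 1, hlt.trans k.2⟩ = i from (idxEquiv m).apply_symm_apply i] at this
    · intro h y hy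
      obtain ⟨j, hj, rfl⟩ := List.getElem_of_mem hy
      rw [hlen] at hj
      rw [List.getElem_take, getElem_word, getElem_word, decide_eq_true_eq]
      exact h _ (by simpa [idx] using hj)
  rw [getElem_capCode, getElem_code]
  have hite : (if 2 ≤ (idxEquiv m k).1 ∧ ∀ i : Idx m, i.1 < (idxEquiv m k).1 →
      window σ (idxEquiv m k) < window σ i then 1 else 0) =
      if 1 ≤ k.1 ∧ ((word σ).take k.1).countP ((word σ)[k.1] < ·) = k.1 then 1 else 0 :=
    if_congr (and_congr (Nat.succ_le_succ_iff (a := 1)) hiff.symm) rfl rfl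
  rw [hite]
  simp only [List.countP_nil, List.length_nil, zero_add]
  split_ifs <;> omega

theorem ellL_eq {m : ℕ} (σ : B m) :
    ellL σ = (capCode [] (word σ)).tail.sum + negSum (word σ) := by
  have h : (capCode [] (word σ)).sum = (capCode [] (word σ)).tail.sum := by
    cases word σ with
    | nil => rfl
    | cons x l => simp [capCode]
  rw [ellL, ellB_eq_lengthStat, lengthStat, sum_code_word, ← h]
  omega

theorem ascSum_eq_sum (u : List ℕ) : ascSum u = ∑ i ∈ Finset.range u.length,
    if 1 ≤ i ∧ u.getD (i - 1) 0 < u.getD i 0 then u.length - i else 0 := by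
  induction u with
  | nil => rfl
  | cons x l ih =>
    rw [List.length_cons, Finset.sum_range_succ']
    cases l with
    | nil => simp [ascSum]
    | cons y l =>
      rw [ascSum, ih, List.length_cons, Finset.sum_range_succ', Finset.sum_range_succ']
      simp only [Nat.le_add_left, true_and, Nat.add_sub_cancel, List.getD_cons_succ,
        List.getD_cons_zero, zero_add, le_refl, Nat.add_sub_add_right, tsub_zero, Nat.sub_self]
      rw [add_comm]
      rfl

/-- Exchanging two adjacent letters does not raise the sum of the capped code exactly when their
entries form an ascent. If both letters are smaller than the whole prefix, the two
entries are the largest ones allowed, in either order, and the sum does not change. -/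
theorem capCode_swap_sum_le_iff (p l : List ℤ) {u v : ℤ} (hp : 2 ≤ p.length) (huv : u ≠ v) :
    (capCode p (v :: u :: l)).sum ≤ (capCode p (u :: v :: l)).sum ↔
      min (p.countP (u < ·)) (p.length - 1) <
        min ((u :: p).countP (v < ·)) ((u :: p).length - 1) := by
  simp only [capCode, List.sum_cons, capCode_perm (.swap u v p), List.countP_cons, List.length_cons,
    decide_eq_true_eq]
  have h1 := List.countP_le_length (p := (u < ·)) (l := p)
  have h2 := List.countP_le_length (p := (v < ·)) (l := p)
  rcases lt_or_gt_of_ne huv with h | h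
  · have h3 : p.countP (v < ·) ≤ p.countP (u < ·) :=
      List.countP_mono_left fun x _ hx => by simp at hx ⊢; omega
    simp only [h, h.le.not_gt, if_true, if_false]
    omega
  · have h3 : p.countP (u < ·) ≤ p.countP (v < ·) :=
      List.countP_mono_left fun x _ hx => by simp at hx ⊢; omega
    simp only [h, h.le.not_gt, if_true, if_false]
    omega

/-- The descents of `σ` are the ascents of its capped code. -/
theorem ellL_mul_a_le_iff {n : ℕ} (σ : B (n + 1)) {i : Fin n} (hi : 1 ≤ i.1) :
    ellL (σ * a i) ≤ ellL σ ↔ (capCode [] (word σ)).tail.getD (i.1 - 1) 0 <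
      (capCode [] (word σ)).tail.getD i.1 0 := by
  have hin := i.2
  have hlen := length_word σ
  have hnd := nodup_word σ
  obtain ⟨A, u, v, l, hw, hA⟩ := exists_word_eq_append σ (i := i.1 + 1) (by omega) (by omega)
  rw [a, ← mul_assoc, ellL_eq, ellL_eq]
  rcases A with _ | ⟨x, A⟩
  · simp at hA; omega
  rcases A with _ | ⟨y, A⟩
  · -- `i = 1`: the word starts with `x, u, v` and that of `σ * a i` with `u, v, x`.
    have h1 := word_mul_s (i := ⟨1, by omega⟩) (A := []) hw rfl
    have h2 := word_mul_s (i := ⟨i.1 + 1, by omega⟩) (A := [u]) h1 hA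
    have hi1 : i.1 = 1 := by simpa using hA
    rw [hw] at hnd
    simp only [List.cons_append, List.nil_append, List.nodup_cons, List.mem_cons, not_or] at hnd
    rw [h2, hw, hi1, negSum_perm (w' := [x] ++ u :: v :: l)
      (by simpa using List.perm_append_comm (l₁ := [u, v]) (l₂ := [x]) |>.append_right l)]
    simp only [List.cons_append, List.nil_append, capCode, List.tail_cons, List.sum_cons,
      Nat.sub_self, List.length_cons, List.length_nil, List.getD_cons_succ, List.getD_cons_zero]
    rw [capCode_perm (show [x, v, u].Perm [v, u, x] from
      List.perm_append_comm (l₁ := [x]) (l₂ := [v, u]))]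
    simp only [List.countP_cons, List.countP_nil, decide_eq_true_eq]
    split_ifs <;> omega
  · -- `i ≥ 2`: the two transpositions are disjoint, and that of `x` and `y` in front does not
    -- affect the capped code.
    have h1 := word_mul_s (i := ⟨1, by omega⟩) (A := []) hw rfl
    have h2 := word_mul_s (i := ⟨i.1 + 1, by omega⟩) (A := y :: x :: A) h1 hA
    have hiA : i.1 = A.length + 1 + 1 := by simpa using hA
    have huv : u ≠ v := by
      rw [hw] at hnd
      rintro rfl
      simpa using (List.nodup_append.1 hnd).2.1
    have hneg : (y :: x :: A ++ v :: u :: l).Perm (x :: y :: A ++ u :: v :: l) :=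
      ((List.Perm.swap x y A).append_right _).trans ((List.Perm.swap u v l).append_left _)
    rw [h2, hw, hiA, negSum_perm hneg]
    simp only [List.cons_append, capCode, List.tail_cons, List.sum_cons]
    rw [capCode_perm (.swap y x []), capCode_append, capCode_append, List.sum_append,
      List.sum_append]
    have key := capCode_swap_sum_le_iff (A.reverse ++ [y, x]) l (by simp) huv
    rw [Nat.add_sub_cancel, List.getD_cons_succ, List.getD_cons_succ,
      List.getD_append_right _ _ _ _ (by simp), List.getD_append_right _ _ _ _ (by simp)]
    simp only [length_capCode, Nat.sub_self, Nat.add_sub_cancel_left, capCode,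
      List.getD_cons_succ, List.getD_cons_zero]
    rw [← key]
    simp [capCode]

theorem rmaj_eq_ascSum {n : ℕ} (π : L (n + 1)) :
    rmaj π = ascSum (capCode [] (word π.1)).tail := by
  rw [rmaj, desA, Finset.sum_filter, ascSum_eq_sum, List.length_tail, length_capCode, length_word,
    Nat.add_sub_cancel, ← Fin.sum_univ_eq_sum_range (fun i =>
      if 1 ≤ i ∧ (capCode [] (word π.1)).tail.getD (i - 1) 0 <
        (capCode [] (word π.1)).tail.getD i 0 then n - i else 0)]
  refine Finset.sum_congr rfl fun i _ => if_congr ?_ rfl rfl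
  exact and_congr_right fun hi => ellL_mul_a_le_iff π.1 hi

/-! ### Summation over the signed even permutations -/

/-- Any choice of letters with distinct absolute values is the window of a signed permutation. -/
theorem exists_window_eq {m : ℕ} (g : Idx m → Letter m)
    (hg : Function.Injective fun i => abs (g i)) : ∃ σ : B m, ∀ i, window σ i = (g i).1 := by
  have habs : ∀ x y : Letter m, abs x = abs y → x = y ∨ x = -y := fun x y h => by
    have h' : x.1.natAbs = y.1.natAbs := congrArg Subtype.val h
    rcases Int.natAbs_eq_natAbs_iff.1 h' with h | h
    · exact Or.inl (Subtype.ext h)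
    · exact Or.inr (Subtype.ext h)
  have hne : ∀ x : Letter m, x.1 ≠ 0 := fun x => (Finset.mem_erase.1 x.2).1
  let f : Letter m → Letter m := fun x => if 0 < x.1 then g (abs x) else -g (abs x)
  have hfabs : ∀ x, abs (f x) = abs (g (abs x)) := fun x => by
    simp only [f]
    split_ifs
    · rfl
    · exact abs_neg _
  have hfneg : ∀ x, f (-x) = -f x := fun x => by
    have := hne x
    simp only [f, abs_neg, Letter.coe_neg]
    split_ifs
    · omega
    · exact (Letter.neg_neg _).symm
    · rfl
    · omega
  have hf : Function.Injective f := fun x y h => by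
    have h1 : abs x = abs y := hg (by simpa only [hfabs] using congrArg abs h)
    rcases habs x y h1 with rfl | rfl
    · rfl
    · rw [hfneg] at h
      have h2 := congrArg Subtype.val h
      have := hne (f y)
      rw [Letter.coe_neg] at h2
      omega
  refine ⟨⟨Equiv.ofBijective f (Finite.injective_iff_bijective.1 hf), hfneg⟩, fun i => ?_⟩
  change (f (pos i)).1 = _
  have hi := Finset.mem_Icc.1 i.2
  have : 0 < (pos i).1 := by simp only [pos]; omega
  simp only [f, this, if_true, abs_pos]

/-- The letters of the words of those `σ` with `Neg(σ⁻¹) = N`: `-i` for `i ∈ N` and `i` for the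
other `i`. -/
def signedValues {m : ℕ} (N : Finset (Idx m)) : Finset ℤ :=
  Finset.univ.image fun i : Idx m => if i ∈ N then -(i.1 : ℤ) else i.1

theorem signedValues_map_injective {m : ℕ} (N : Finset (Idx m)) :
    Function.Injective fun i : Idx m => if i ∈ N then -(i.1 : ℤ) else i.1 := by
  intro i j h
  have hi := Finset.mem_Icc.1 i.2
  have hj := Finset.mem_Icc.1 j.2
  apply Subtype.ext
  simp only at h
  split_ifs at h <;> omega

theorem neg_mem_signedValues {m : ℕ} {N : Finset (Idx m)} {i : Idx m} :
    -(i.1 : ℤ) ∈ signedValues N ↔ i ∈ N := by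
  have hi := Finset.mem_Icc.1 i.2
  rw [signedValues, Finset.mem_image]
  constructor
  · rintro ⟨j, -, h⟩
    have hj := Finset.mem_Icc.1 j.2
    split_ifs at h with hjN
    · rwa [show i = j from Subtype.ext (by omega)]
    · omega
  · intro h
    exact ⟨i, Finset.mem_univ _, by simp [h]⟩

theorem toFinset_word {m : ℕ} (σ : B m) : (word σ).toFinset = signedValues (negSet σ⁻¹) := by
  symm
  apply Finset.eq_of_subset_of_card_le
  · intro x hx
    obtain ⟨i, -, rfl⟩ := Finset.mem_image.1 hx
    rw [List.mem_toFinset, mem_word]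
    have hi := Finset.mem_Icc.1 i.2
    have happ : σ.1 ((σ⁻¹).1 (pos i)) = pos i := σ.1.apply_symm_apply (pos i)
    refine ⟨abs ((σ⁻¹).1 (pos i)), ?_⟩
    have hmem : i ∈ negSet σ⁻¹ ↔ ((σ⁻¹).1 (pos i)).1 < 0 := by
      rw [negSet, Finset.mem_filter]
      exact and_iff_right (Finset.mem_univ _)
    have hx0 := (Finset.mem_erase.1 ((σ⁻¹).1 (pos i)).2).1
    rw [window]
    split_ifs with h
    · rw [hmem] at h
      have : pos (abs ((σ⁻¹).1 (pos i))) = -(σ⁻¹).1 (pos i) := Subtype.ext (by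
        simp only [pos, abs, Letter.coe_neg]
        simp only [pos] at h
        omega)
      rw [this, map_neg, happ]
      rfl
    · rw [hmem] at h
      have : pos (abs ((σ⁻¹).1 (pos i))) = (σ⁻¹).1 (pos i) := Subtype.ext (by
        simp only [pos, abs]
        simp only [pos] at h
        omega)
      rw [this, happ]
      rfl
  · rw [List.toFinset_card_of_nodup (nodup_word σ), length_word, signedValues,
      Finset.card_image_of_injective _ (signedValues_map_injective _)]
    simp

theorem toFinset_word_eq_iff {m : ℕ} (σ : B m) (N : Finset (Idx m)) :
    (word σ).toFinset = signedValues N ↔ negSet σ⁻¹ = N := by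
  rw [toFinset_word]
  refine ⟨fun h => ?_, fun h => by rw [h]⟩
  ext i
  rw [← neg_mem_signedValues, h, neg_mem_signedValues]

theorem negSum_word {m : ℕ} (σ : B m) : negSum (word σ) = ∑ i ∈ negSet σ⁻¹, i.1 := by
  rw [negSum, ← List.sum_toFinset _ (nodup_word σ), toFinset_word, signedValues,
    Finset.sum_image (signedValues_map_injective _).injOn,
    ← Finset.sum_filter_add_sum_filter_not Finset.univ (· ∈ negSet σ⁻¹)]
  rw [Finset.sum_eq_zero (s := Finset.univ.filter (· ∉ negSet σ⁻¹)), add_zero,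
    Finset.filter_univ_mem]
  · refine Finset.sum_congr rfl fun i hi => ?_
    simp [hi]
  · intro i hi
    simp [(Finset.mem_filter.1 hi).2]

theorem exists_word_eq {m : ℕ} (N : Finset (Idx m)) {w : List ℤ} (hw : w.Nodup)
    (hN : w.toFinset = signedValues N) : ∃ σ : B m, word σ = w := by
  have hlen : w.length = m := by
    rw [← List.toFinset_card_of_nodup hw, hN, signedValues,
      Finset.card_image_of_injective _ (signedValues_map_injective _)]
    simp
  have hval : ∀ k : Fin m, ∃ i : Idx m, (if i ∈ N then -(i.1 : ℤ) else i.1) = w[k.1] := fun k => by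
    have : w[k.1] ∈ signedValues N := by
      rw [← hN, List.mem_toFinset]
      exact List.getElem_mem _
    obtain ⟨i, -, h⟩ := Finset.mem_image.1 this
    exact ⟨i, h⟩
  choose v hv using hval
  have hvinj : Function.Injective v := fun k l h => by
    have h' := hv k
    rw [h, hv l] at h'
    exact Fin.ext ((hw.getElem_inj_iff).1 h').symm
  let g : Idx m → Letter m := fun i =>
    if v ((idxEquiv m).symm i) ∈ N then -pos (v ((idxEquiv m).symm i))
    else pos (v ((idxEquiv m).symm i))
  have habs : ∀ i, abs (g i) = v ((idxEquiv m).symm i) := fun i => by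
    simp only [g]
    split_ifs
    · rw [abs_neg, abs_pos]
    · rw [abs_pos]
  obtain ⟨σ, hσ⟩ := exists_window_eq g (fun i j h => by
    simp only [habs] at h
    exact (idxEquiv m).symm.injective (hvinj h))
  refine ⟨σ, List.ext_getElem (by simp [hlen]) fun k h1 h2 => ?_⟩
  rw [getElem_word, hσ, ← hv ⟨k, by omega⟩]
  simp only [g]
  rw [show (idxEquiv m).symm (idx ⟨k, by omega⟩) = ⟨k, by omega⟩ from
    (idxEquiv m).symm_apply_apply _]
  split_ifs <;> rfl

theorem word_perm_sort_iff {m : ℕ} (σ : B m) (N : Finset (Idx m)) :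
    (word σ).Perm ((signedValues N).sort (· ≥ ·)) ↔ negSet σ⁻¹ = N := by
  rw [← toFinset_word_eq_iff]
  refine ⟨fun h => ?_, fun h => ?_⟩
  · rw [List.toFinset_eq_of_perm _ _ h, Finset.sort_toFinset]
  · exact List.perm_of_nodup_nodup_toFinset_eq (nodup_word σ) (Finset.sort_nodup ..)
      (by rw [h, Finset.sort_toFinset])

noncomputable instance (m : ℕ) : Fintype (B m) := Fintype.ofFinite _

/-- The words of the `σ` with `Neg(σ⁻¹) = N` are the arrangements of `signedValues N`. -/
theorem sum_negSet_eq {m : ℕ} (N : Finset (Idx m)) (f : List ℤ → ℤ[X]) :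
    ∑ σ : B m with negSet σ⁻¹ = N, f (word σ) =
      (((signedValues N).sort (· ≥ ·)).permutations'.map f).sum := by
  have hnd : ((signedValues N).sort (· ≥ ·)).permutations'.Nodup :=
    (List.permutations_perm_permutations' _).nodup_iff.1
      (List.nodup_permutations _ (Finset.sort_nodup ..))
  rw [← List.sum_toFinset _ hnd, ← Finset.sum_image (f := f) word_injective.injOn]
  congr 1
  ext w
  rw [Finset.mem_image, List.mem_toFinset, List.mem_permutations']
  constructor
  · rintro ⟨σ, hσ, rfl⟩
    exact (word_perm_sort_iff σ N).2 (Finset.mem_filter.1 hσ).2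
  · intro h
    obtain ⟨σ, rfl⟩ := exists_word_eq N (h.nodup_iff.2 (Finset.sort_nodup ..))
      (by rw [List.toFinset_eq_of_perm _ _ h, Finset.sort_toFinset])
    exact ⟨σ, by simpa using (word_perm_sort_iff σ N).1 h, rfl⟩

theorem Abs_signedSwap {m : ℕ} (a b : Idx m) : Abs m (signedSwap a b) = Equiv.swap a b := by
  ext j
  have := window_mul_signedSwap 1 a b j
  rw [← natAbs_window, ← one_mul (signedSwap a b), this]
  simp [window, pos]

theorem mul_s_one_mem_L_iff {m : ℕ} (h : 1 < m) (σ : B m) :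
    σ * s ⟨1, h⟩ ∈ L m ↔ σ ∉ L m := by
  have hs : s (⟨1, h⟩ : Fin m) = signedSwap ⟨1, by simp; omega⟩ ⟨2, by simp; omega⟩ :=
    dif_neg one_ne_zero
  rw [L, Subgroup.mem_comap, Subgroup.mem_comap, Equiv.Perm.mem_alternatingGroup,
    Equiv.Perm.mem_alternatingGroup, map_mul, Equiv.Perm.sign_mul, hs, Abs_signedSwap,
    Equiv.Perm.sign_swap (by simp)]
  rcases Int.units_eq_one_or (Equiv.Perm.sign (Abs m σ)) with h | h <;> simp [h]

theorem tail_capCode_word_mul_s_one {m : ℕ} (h : 1 < m) (σ : B m) :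
    (capCode [] (word (σ * s ⟨1, h⟩))).tail = (capCode [] (word σ)).tail := by
  obtain ⟨A, x, y, l, hw, hA⟩ := exists_word_eq_append σ one_pos h
  have hA : A = [] := List.eq_nil_of_length_eq_zero (by omega)
  subst hA
  rw [word_mul_s hw rfl, hw]
  simp [capCode, capCode_perm (.swap x y [])]

theorem negSet_inv_mul_s_one {m : ℕ} (h : 1 < m) (σ : B m) :
    negSet (σ * s ⟨1, h⟩)⁻¹ = negSet σ⁻¹ := by
  obtain ⟨A, x, y, l, hw, hA⟩ := exists_word_eq_append σ one_pos h
  rw [← toFinset_word_eq_iff, ← toFinset_word, word_mul_s hw hA, hw]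
  exact List.toFinset_eq_of_perm _ _ ((List.Perm.swap x y l).append_left A)

/-- Right multiplication by `s_1` matches the even with the odd signed permutations and preserves
the capped code. -/
theorem two_mul_sum_L {m : ℕ} (h : 1 < m) (N : Finset (Idx m)) (f : List ℕ → ℤ[X]) :
    2 * ∑ π : L m with negSet (π.1⁻¹) = N, f (capCode [] (word π.1)).tail =
      ∑ σ : B m with negSet σ⁻¹ = N, f (capCode [] (word σ)).tail := by
  classical
  rw [← Finset.sum_filter_add_sum_filter_not _ (· ∈ L m), Finset.filter_filter,
    Finset.filter_filter, two_mul]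
  have h1 : ∑ π : L m with negSet (π.1⁻¹) = N, f (capCode [] (word π.1)).tail =
      ∑ σ : B m with negSet σ⁻¹ = N ∧ σ ∈ L m, f (capCode [] (word σ)).tail := by
    refine Finset.sum_bij (fun π _ => π.1) ?_ ?_ ?_ ?_
    · intro π hπ
      exact Finset.mem_filter.2 ⟨Finset.mem_univ _, (Finset.mem_filter.1 hπ).2, π.2⟩
    · intro π _ ρ _ h
      exact Subtype.ext h
    · intro σ hσ
      have := (Finset.mem_filter.1 hσ).2
      exact ⟨⟨σ, this.2⟩, Finset.mem_filter.2 ⟨Finset.mem_univ _, this.1⟩, rfl⟩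
    · intro π _
      rfl
  rw [h1]
  congr 1
  refine Finset.sum_bij (fun σ _ => σ * s ⟨1, h⟩) ?_ ?_ ?_ ?_
  · intro σ hσ
    have := (Finset.mem_filter.1 hσ).2
    simp only [Finset.mem_filter, Finset.mem_univ, true_and]
    rw [negSet_inv_mul_s_one, mul_s_one_mem_L_iff]
    simpa using this
  · intro σ _ τ _ h
    exact mul_right_cancel h
  · intro σ hσ
    have := (Finset.mem_filter.1 hσ).2
    refine ⟨σ * s ⟨1, h⟩, ?_, mul_s_mul_s _ _⟩
    simp only [Finset.mem_filter, Finset.mem_univ, true_and]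
    rw [negSet_inv_mul_s_one, mul_s_one_mem_L_iff]
    exact this
  · intro σ _
    rw [tail_capCode_word_mul_s_one]

theorem nrmaj_eq {n : ℕ} (π : L (n + 1)) :
    nrmaj π = ascSum (capCode [] (word π.1)).tail + negSum (word π.1) := by
  rw [nrmaj, rmaj_eq_ascSum, negSum_word]

end SignedPerm

/-- For every `B ⊆ [n+1]`, the statistics `nrmaj` and `ℓ_L` have the same generating polynomial
(in the indeterminate `q = Polynomial.X`) over the `π ∈ L_{n+1}` with `Neg(π⁻¹) = B`. -/
theorem corollary3p2 (n : ℕ) (B : Finset (SignedPerm.Idx (n + 1))) :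
    ∑ π : SignedPerm.L (n + 1) with SignedPerm.negSet (π.1⁻¹) = B,
        (Polynomial.X : Polynomial ℤ) ^ SignedPerm.nrmaj π =
      ∑ π : SignedPerm.L (n + 1) with SignedPerm.negSet (π.1⁻¹) = B,
        (Polynomial.X : Polynomial ℤ) ^ SignedPerm.ellL π.1 := by
  have hfactor : ∀ f g : SignedPerm.L (n + 1) → ℕ,
      (∀ π, f π = g π + SignedPerm.negSum (SignedPerm.word π.1)) →
      ∑ π : SignedPerm.L (n + 1) with SignedPerm.negSet (π.1⁻¹) = B,
        (Polynomial.X : Polynomial ℤ) ^ f π =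
      (∑ π : SignedPerm.L (n + 1) with SignedPerm.negSet (π.1⁻¹) = B,
        (Polynomial.X : Polynomial ℤ) ^ g π) * Polynomial.X ^ ∑ i ∈ B, i.1 := by
    intro f g h
    rw [Finset.sum_mul]
    refine Finset.sum_congr rfl fun π hπ => ?_
    rw [h, pow_add, SignedPerm.negSum_word, (Finset.mem_filter.1 hπ).2]
  rw [hfactor _ _ SignedPerm.nrmaj_eq, hfactor _ _ fun π => SignedPerm.ellL_eq π.1]
  congr 1
  rcases Nat.eq_zero_or_pos n with rfl | hn
  · -- For `m = 1` there is no `s_1`, but both statistics vanish on the empty list.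
    refine Finset.sum_congr rfl fun π _ => ?_
    have hlen : (SignedPerm.capCode [] (SignedPerm.word π.1)).tail.length = 0 := by simp
    rw [List.eq_nil_of_length_eq_zero hlen]
    rfl
  · apply mul_left_cancel₀ (two_ne_zero (α := Polynomial ℤ))
    rw [SignedPerm.two_mul_sum_L (by omega) B fun u => Polynomial.X ^ SignedPerm.ascSum u,
      SignedPerm.two_mul_sum_L (by omega) B fun u => Polynomial.X ^ u.sum,
      SignedPerm.sum_negSet_eq B fun w =>
        Polynomial.X ^ SignedPerm.ascSum (SignedPerm.capCode [] w).tail,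
      SignedPerm.sum_negSet_eq B fun w => Polynomial.X ^ (SignedPerm.capCode [] w).tail.sum]
    exact SignedPerm.sum_ascSum_eq_sum_sum _ (Finset.sortedGT_sort _).pairwise
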